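/- A (finite) hypergraph $H=(V,E)$ consists of a finite vertex set $V$ and a set $E$ of subsets of $V$ (so there are no repeated edges); it is $r$-uniform if every edge has exactly $r$ vertices, and its maximum degree is the largest number of edges containing a common vertex. A balanced separator of $H$ is a set $R\subseteq E$ such that every connected component of $(V,E\setminus R)$ is incident to at most $|E|/2$ edges of $E\setminus R$. For $r\ge 2$ put $\epsilon_r=(1-2^{-1/r})^r$. Theorem. Fix $r\ge 2$. (a) There is a constant $C=C(r)>0$ such that, for all sequences of natural numbers $(k_i)$, $(m_i)$ with $k_i\to\infty$, $m_i\to\infty$ and $k_i=o(m_i)$, there are $r$-uniform hypergraphs $H_i$ with exactly $m_i$ edges and reals $\delta_i\to 0$ such that $H_i$ has maximum degree at most $C k_i$ for all sufficiently large $i$, and every balanced separator of $H_i$ has at least $\left(\tfrac12-\epsilon_r\right)m_i(1-\delta_i)$ edges. (b) Consequently the constant $\epsilon_r$ is tight as a saving for balanced separators: for no $\epsilon>\epsilon_r$ is it true that all hypergraphs with $m\to\infty$ edges, each of size at most $r$, and maximum degree $o(\sqrt m)$ have balanced separators of size at most $\left(\tfrac12-\epsilon\right)m+o(m)$. -/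

import Mathlib

open Filter Topology Asymptotics
open scoped Hypergraph

namespace Hypergraph

/-- All hyperedges have exactly `r` vertices. -/
def IsUniform {α : Type*} (H : Hypergraph α) (r : ℕ) : Prop :=
  ∀ e ∈ E(H), e.ncard = r

/-- The number of hyperedges containing the vertex `v`. -/
noncomputable def degree {α : Type*} (H : Hypergraph α) (v : α) : ℕ :=
  {e ∈ E(H) | v ∈ e}.ncard

/-- The maximum vertex degree; points outside the vertex set have degree `0`. -/
noncomputable def maxDegree {α : Type*} [Fintype α] (H : Hypergraph α) : ℕ :=
  Finset.univ.sup H.degree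

/-- The hypergraph `(V, E \ R)`. -/
def deleteEdges {α : Type*} (H : Hypergraph α) (R : Set (Set α)) : Hypergraph α where
  vertexSet := V(H)
  edgeSet := E(H) \ R
  subset_vertexSet_of_mem_edgeSet' := fun _ he => H.subset_vertexSet_of_mem_edgeSet' he.1

/-- A nonempty set `S` of vertices is connected if any two of its vertices are joined by a sequence
of consecutively intersecting hyperedges, all of them contained in `S` (a single vertex counts as
joined to itself). -/
def IsConnectedSet {α : Type*} (H : Hypergraph α) (S : Set α) : Prop :=
  S ⊆ V(H) ∧ S.Nonempty ∧
    ∀ u ∈ S, ∀ v ∈ S, Relation.ReflTransGen (fun x y => ∃ e ∈ E(H), e ⊆ S ∧ x ∈ e ∧ y ∈ e) u v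

/-- A connected component is a maximal connected set of vertices. -/
def IsComponent {α : Type*} (H : Hypergraph α) (S : Set α) : Prop :=
  Maximal H.IsConnectedSet S

/-- `R ⊆ E` is a balanced separator if every connected component of `(V, E \ R)` is incident to at
most `|E| / 2` hyperedges of `E \ R`. -/
def IsBalancedSeparator {α : Type*} (H : Hypergraph α) (R : Set (Set α)) : Prop :=
  R ⊆ E(H) ∧ ∀ S : Set α, (H.deleteEdges R).IsComponent S →
    ({e ∈ E(H) \ R | (e ∩ S).Nonempty}.ncard : ℝ) ≤ (E(H).ncard : ℝ) / 2

end Hypergraph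

/-- The constant `ε_r = (1 - 2 ^ (-1 / r)) ^ r`. -/
noncomputable def separatorConst (r : ℕ) : ℝ :=
  (1 - (2 : ℝ) ^ (-1 / (r : ℝ))) ^ r

/-- The separator bound with saving `ε`: finite hypergraphs with `m → ∞` hyperedges, each of size at
most `r`, and maximum degree `o(√m)` have balanced separators of size at most
`(1 / 2 - ε) m + o(m)`. -/
def SeparatorBound (r : ℕ) (ε : ℝ) : Prop :=
  ∀ (n : ℕ → ℕ) (H : ∀ i, Hypergraph (Fin (n i))),
    (∀ i, ∀ e ∈ E(H i), e.ncard ≤ r) →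
    Tendsto (fun i => E(H i).ncard) atTop atTop →
    (fun i => ((H i).maxDegree : ℝ)) =o[atTop] (fun i => √(E(H i).ncard : ℝ)) →
    ∃ err : ℕ → ℝ, err =o[atTop] (fun i => (E(H i).ncard : ℝ)) ∧
      ∀ i, ∃ R, (H i).IsBalancedSeparator R ∧
        (R.ncard : ℝ) ≤ (1 / 2 - ε) * (E(H i).ncard : ℝ) + err i

/-!
If the hyperedges of an `r`-uniform hypergraph behave like independent random `r`-tuples of
vertices, then a vertex set of measure `t` spans about a proportion `t ^ r` of them. Let
`β ^ r = 1 / 2`, so that `ε_r = (1 - β) ^ r`, and delete a balanced separator. Either some component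
has measure at least `β`: it meets at most half of the hyperedges, and its complement spans at most
a proportion `(1 - β) ^ r`. Or, since `β ≥ 2 / 3`, some union of components has measure
`t ∈ [1 - β, β]`, and what remains is a proportion at most
`t ^ r + (1 - t) ^ r ≤ β ^ r + (1 - β) ^ r`, by convexity. In both cases at most `1 / 2 + ε_r` of
the hyperedges survive.

Such hypergraphs come from `m` independent uniform `r`-tuples of `n` vertices, where `n = o(m)` is
much larger than both `√m` and `m / k`. Because `n = o(m)`, Hoeffding's inequality and a union bound
over the `2 ^ n` vertex sets give quasirandomness. Because `√m = o(n)` and `m / k = o(n)`, only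
`o(m)` of the tuples have a repeated entry, lie inside another tuple or contain a vertex of `k`
other tuples; moving these to new vertices makes the tuples distinct hyperedges of size `r`, with
maximum degree at most `k`.
-/

open MeasureTheory ProbabilityTheory

section Components

variable {α : Type*} {H : Hypergraph α}

/-- The set of vertices reachable from `v` along hyperedges: the connected component of `v` when
`v ∈ V(H)`, and `{v}` otherwise. -/
def reachableSet (H : Hypergraph α) (v : α) : Set α :=
  {u | Relation.ReflTransGen H.Adj v u}

/-- A set that no hyperedge crosses, that is, a union of connected components. -/
def IsClosedUnderEdges (H : Hypergraph α) (A : Set α) : Prop :=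
  ∀ e ∈ E(H), e ⊆ A ∨ e ⊆ Aᶜ

theorem mem_reachableSet_self (H : Hypergraph α) (v : α) : v ∈ reachableSet H v :=
  Relation.ReflTransGen.refl

theorem mem_reachableSet_comm {u v : α} : u ∈ reachableSet H v ↔ v ∈ reachableSet H u :=
  have : Std.Symm H.Adj := ⟨fun _ _ h => h.symm⟩
  ⟨fun h => Relation.ReflTransGen.stdSymm.symm _ _ h,
    fun h => Relation.ReflTransGen.stdSymm.symm _ _ h⟩

theorem subset_reachableSet {v x : α} {e : Set α} (he : e ∈ E(H)) (hxe : x ∈ e)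
    (hx : x ∈ reachableSet H v) : e ⊆ reachableSet H v :=
  fun _ hy => hx.tail ⟨e, he, hxe, hy⟩

theorem reachableSet_subset_vertexSet {v : α} (hv : v ∈ V(H)) : reachableSet H v ⊆ V(H) := by
  intro u hu
  induction hu with
  | refl => exact hv
  | tail _ hadj _ =>
    obtain ⟨e, he, -, hue⟩ := hadj
    exact H.mem_vertexSet_of_mem_edgeSet he hue

theorem isClosedUnderEdges_empty : IsClosedUnderEdges H ∅ :=
  fun e _ => Or.inr (by simp only [Set.compl_empty, Set.subset_univ])

theorem isClosedUnderEdges_reachableSet (v : α) : IsClosedUnderEdges H (reachableSet H v) := by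
  intro e he
  by_cases h : ∃ x ∈ e, x ∈ reachableSet H v
  · obtain ⟨x, hxe, hx⟩ := h
    exact Or.inl (subset_reachableSet he hxe hx)
  · exact Or.inr fun x hxe hx => h ⟨x, hxe, hx⟩

theorem IsClosedUnderEdges.union {A B : Set α} (hA : IsClosedUnderEdges H A)
    (hB : IsClosedUnderEdges H B) : IsClosedUnderEdges H (A ∪ B) := by
  intro e he
  rcases hA e he with h | h
  · exact Or.inl (h.trans Set.subset_union_left)
  rcases hB e he with h' | h'
  · exact Or.inl (h'.trans Set.subset_union_right)
  · exact Or.inr fun x hx hx' => hx'.elim (h hx) (h' hx)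

theorem isConnectedSet_reachableSet {v : α} (hv : v ∈ V(H)) :
    H.IsConnectedSet (reachableSet H v) := by
  set S := reachableSet H v
  let adjIn : α → α → Prop := fun x y => ∃ e ∈ E(H), e ⊆ S ∧ x ∈ e ∧ y ∈ e
  have : Std.Symm adjIn := ⟨fun x y ⟨e, he, heS, hx, hy⟩ => ⟨e, he, heS, hy, hx⟩⟩
  have hreach : ∀ u ∈ S, Relation.ReflTransGen adjIn v u := by
    intro u hu
    induction hu with
    | refl => exact Relation.ReflTransGen.refl
    | tail hx hadj ih =>
      obtain ⟨e, he, hxe, hye⟩ := hadj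
      exact ih.tail ⟨e, he, subset_reachableSet he hxe hx, hxe, hye⟩
  exact ⟨reachableSet_subset_vertexSet hv, ⟨v, mem_reachableSet_self H v⟩, fun u hu u' hu' =>
    (Relation.ReflTransGen.stdSymm.symm _ _ (hreach u hu)).trans (hreach u' hu')⟩

theorem isComponent_reachableSet {v : α} (hv : v ∈ V(H)) : H.IsComponent (reachableSet H v) := by
  refine ⟨isConnectedSet_reachableSet hv, fun T hT hST u hu => ?_⟩
  exact (hT.2.2 v (hST (mem_reachableSet_self H v)) u hu).lift id
    fun x y ⟨e, he, _, hx, hy⟩ => ⟨e, he, hx, hy⟩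

theorem exists_reachableSet_or_isClosedUnderEdges [Finite α] [MeasurableSpace α]
    (H : Hypergraph α) (μ : Measure α) [IsProbabilityMeasure μ] {β : ℝ}
    (hβ : 2 / 3 ≤ β) :
    (∃ v, β ≤ μ.real (reachableSet H v)) ∨
      ∃ B, IsClosedUnderEdges H B ∧ 1 - β ≤ μ.real B ∧ μ.real B ≤ β := by
  by_contra! ⟨hsmall, hgap⟩
  have hclosed_small {B : Set α} (hB : IsClosedUnderEdges H B) (h : μ.real B ≤ β) :
      μ.real B < 1 - β := by
    by_contra! hB'
    exact (hgap B hB hB').not_ge h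
  -- Adding one more component to a maximal union of components of measure at most `β` would exceed
  -- `β`, although both parts have measure less than `1 - β ≤ 1 / 3`.
  obtain ⟨A, hA⟩ := (Set.toFinite {A | IsClosedUnderEdges H A ∧ μ.real A ≤ β}).exists_maximal
    ⟨∅, isClosedUnderEdges_empty, by rw [measureReal_empty]; linarith⟩
  have hA_small := hclosed_small hA.prop.1 hA.prop.2
  obtain ⟨x, hx⟩ : ∃ x, x ∉ A := by
    refine (Set.ne_univ_iff_exists_notMem A).1 fun h => ?_
    rw [h, probReal_univ] at hA_small
    linarith
  have hS := isClosedUnderEdges_reachableSet (H := H) x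
  have hS_small := hclosed_small hS (hsmall x).le
  have hunion : μ.real (A ∪ reachableSet H x) ≤ β :=
    (measureReal_union_le _ _).trans (by linarith)
  exact hx (hA.le_of_ge ⟨hA.prop.1.union hS, hunion⟩ Set.subset_union_left
    (Or.inr (mem_reachableSet_self H x)))

end Components

section HalfRoot

/-- The measure `β` with `β ^ r = 1 / 2`: a set of this measure spans about half of the hyperedges
of an `r`-uniform hypergraph that is quasirandom for the measure. -/
noncomputable def halfRoot (r : ℕ) : ℝ :=
  2 ^ (-1 / (r : ℝ))

theorem halfRoot_pow {r : ℕ} (hr : r ≠ 0) : halfRoot r ^ r = 1 / 2 := by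
  rw [halfRoot, ← Real.rpow_mul_natCast zero_le_two, div_mul_cancel₀ _ (Nat.cast_ne_zero.2 hr),
    Real.rpow_neg_one, one_div]

theorem halfRoot_pos (r : ℕ) : 0 < halfRoot r :=
  Real.rpow_pos_of_pos two_pos _

theorem halfRoot_le_one (r : ℕ) : halfRoot r ≤ 1 :=
  Real.rpow_le_one_of_one_le_of_nonpos one_le_two
    (div_nonpos_of_nonpos_of_nonneg (by norm_num) r.cast_nonneg)

theorem two_thirds_le_halfRoot {r : ℕ} (hr : 2 ≤ r) : 2 / 3 ≤ halfRoot r := by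
  have h_sq : 1 / 2 ≤ halfRoot r ^ 2 := by
    rw [← halfRoot_pow (r := r) (by lia)]
    exact pow_le_pow_of_le_one (halfRoot_pos r).le (halfRoot_le_one r) hr
  nlinarith [halfRoot_pos r]

theorem separatorConst_lt_half {r : ℕ} (hr : 2 ≤ r) : separatorConst r < 1 / 2 := by
  have hβ := two_thirds_le_halfRoot hr
  have h_le : separatorConst r ≤ 1 - halfRoot r :=
    pow_le_of_le_one (sub_nonneg.2 (halfRoot_le_one r))
      (sub_le_self 1 (halfRoot_pos r).le) (by lia)
  linarith

theorem convexOn_pow_add_one_sub_pow (r : ℕ) :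
    ConvexOn ℝ (Set.Icc 0 1) fun t : ℝ => t ^ r + (1 - t) ^ r := by
  have h_left : ConvexOn ℝ (Set.Icc 0 1) fun t : ℝ => t ^ r :=
    (convexOn_pow r).subset Set.Icc_subset_Ici_self (convex_Icc 0 1)
  have h_right : ConvexOn ℝ (Set.Icc 0 1) fun t : ℝ => (1 - t) ^ r := by
    refine ((convexOn_pow r).comp_affineMap (AffineMap.lineMap (1 : ℝ) 0)).subset
      (fun t ht => ?_) (convex_Icc 0 1) |>.congr fun t _ => ?_
    · simpa [AffineMap.lineMap_apply] using ht.2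
    · simp only [Function.comp_apply, AffineMap.lineMap_apply_ring]
      ring
  exact h_left.add h_right

theorem pow_add_one_sub_pow_le {β t : ℝ} (r : ℕ) (hβ : β ≤ 1) (ht : t ∈ Set.Icc (1 - β) β) :
    t ^ r + (1 - t) ^ r ≤ β ^ r + (1 - β) ^ r := by
  have hβ' : 1 - β ≤ β := ht.1.trans ht.2
  have h := (convexOn_pow_add_one_sub_pow r).le_max_of_mem_Icc
    (x := 1 - β) (y := β) ⟨by linarith, by linarith⟩ ⟨by linarith, hβ⟩ ht
  simpa [add_comm] using h

end HalfRoot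

section Quasirandom

variable {α : Type*} {H : Hypergraph α}

/-- A one-sided quasirandomness property: up to an error of `δ |E|`, a set of vertices spans at most
the number of hyperedges that it would span if these were `r`-tuples of independent vertices with
distribution `μ`. -/
def IsQuasirandom [MeasurableSpace α] (H : Hypergraph α) (μ : Measure α) (r : ℕ) (δ : ℝ) : Prop :=
  ∀ S : Set α, ({e ∈ E(H) | e ⊆ S}.ncard : ℝ) ≤ (μ.real S ^ r + δ) * E(H).ncard

theorem ncard_inter_reachableSet_le_of_isBalancedSeparator {R : Set (Set α)}
    (hR : H.IsBalancedSeparator R) (v : α) :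
    ({e ∈ E(H) \ R | (e ∩ reachableSet (H.deleteEdges R) v).Nonempty}.ncard : ℝ) ≤
      E(H).ncard / 2 := by
  by_cases hv : v ∈ V(H)
  · exact hR.2 _ (isComponent_reachableSet hv)
  have hempty : {e ∈ E(H) \ R | (e ∩ reachableSet (H.deleteEdges R) v).Nonempty} = ∅ := by
    refine Set.eq_empty_of_forall_notMem fun e ⟨he, x, hxe, hx⟩ => hv ?_
    have hxV : x ∈ V(H.deleteEdges R) := H.mem_vertexSet_of_mem_edgeSet he.1 hxe
    exact reachableSet_subset_vertexSet hxV (mem_reachableSet_comm.1 hx)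
  rw [hempty, Set.ncard_empty, Nat.cast_zero]
  positivity

theorem ncard_le_add_of_forall_or {β : Type*} [Finite β] {E : Set β} {p q : β → Prop}
    (hpq : ∀ e ∈ E, p e ∨ q e) :
    (E.ncard : ℝ) ≤ {e ∈ E | p e}.ncard + {e ∈ E | q e}.ncard := by
  have hsub : E ⊆ {e ∈ E | p e} ∪ {e ∈ E | q e} := fun e he =>
    (hpq e he).imp (fun h => ⟨he, h⟩) fun h => ⟨he, h⟩
  exact_mod_cast (Set.ncard_le_ncard hsub (Set.toFinite _)).trans (Set.ncard_union_le _ _)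

variable [MeasurableSpace α] {μ : Measure α} {r : ℕ} {δ : ℝ}

theorem IsQuasirandom.error_nonneg (h : IsQuasirandom H μ r δ) (hr : r ≠ 0) :
    0 ≤ δ * E(H).ncard := by
  have h_empty := (Nat.cast_nonneg _).trans (h ∅)
  rwa [measureReal_empty, zero_pow hr, zero_add] at h_empty

variable [Finite α]

theorem IsQuasirandom.ncard_sdiff_le (h : IsQuasirandom H μ r δ) (R : Set (Set α)) (S : Set α) :
    ({e ∈ E(H) \ R | e ⊆ S}.ncard : ℝ) ≤ (μ.real S ^ r + δ) * E(H).ncard := by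
  have hsub : {e ∈ E(H) \ R | e ⊆ S} ⊆ {e ∈ E(H) | e ⊆ S} := fun e he => ⟨he.1.1, he.2⟩
  exact (Nat.cast_le.2 (Set.ncard_le_ncard hsub (Set.toFinite _))).trans (h S)

variable [DiscreteMeasurableSpace α] [IsProbabilityMeasure μ]

theorem IsQuasirandom.ncard_sdiff_le_of_isBalancedSeparator (h : IsQuasirandom H μ r δ)
    (hr : 2 ≤ r) {R : Set (Set α)} (hR : H.IsBalancedSeparator R) :
    ((E(H) \ R).ncard : ℝ) ≤ (1 / 2 + separatorConst r + 2 * δ) * E(H).ncard := by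
  have hδ := h.error_nonneg (by lia)
  have hβ_pow : halfRoot r ^ r = 1 / 2 := halfRoot_pow (by lia)
  rcases exists_reachableSet_or_isClosedUnderEdges (H.deleteEdges R) μ
    (two_thirds_le_halfRoot hr) with ⟨v, hv⟩ | ⟨B, hB, hB_ge, hB_le⟩
  · set S := reachableSet (H.deleteEdges R) v
    have h_meet_or_avoid : ((E(H) \ R).ncard : ℝ) ≤
        {e ∈ E(H) \ R | (e ∩ S).Nonempty}.ncard + {e ∈ E(H) \ R | e ⊆ Sᶜ}.ncard :=
      ncard_le_add_of_forall_or fun e _ =>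
        or_iff_not_imp_left.2 fun he x hxe hxS => he ⟨x, hxe, hxS⟩
    have h_avoid_le : μ.real Sᶜ ^ r ≤ separatorConst r :=
      pow_le_pow_left₀ measureReal_nonneg (by
        rw [probReal_compl_eq_one_sub .of_discrete]; exact sub_le_sub_left hv 1) r
    calc ((E(H) \ R).ncard : ℝ)
        ≤ E(H).ncard / 2 + (μ.real Sᶜ ^ r + δ) * E(H).ncard :=
          h_meet_or_avoid.trans (add_le_add
            (ncard_inter_reachableSet_le_of_isBalancedSeparator hR v) (h.ncard_sdiff_le R Sᶜ))
      _ ≤ E(H).ncard / 2 + (separatorConst r + δ) * E(H).ncard := by gcongr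
      _ ≤ (1 / 2 + separatorConst r + 2 * δ) * E(H).ncard := by linarith
  · have h_span : μ.real B ^ r + (1 - μ.real B) ^ r ≤ 1 / 2 + separatorConst r := by
      rw [← hβ_pow]
      exact pow_add_one_sub_pow_le r (halfRoot_le_one r) ⟨hB_ge, hB_le⟩
    calc ((E(H) \ R).ncard : ℝ)
        ≤ (μ.real B ^ r + δ) * E(H).ncard + (μ.real Bᶜ ^ r + δ) * E(H).ncard :=
          (ncard_le_add_of_forall_or hB).trans
            (add_le_add (h.ncard_sdiff_le R B) (h.ncard_sdiff_le R Bᶜ))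
      _ = (μ.real B ^ r + (1 - μ.real B) ^ r + 2 * δ) * E(H).ncard := by
          rw [probReal_compl_eq_one_sub .of_discrete]; ring
      _ ≤ (1 / 2 + separatorConst r + 2 * δ) * E(H).ncard := by gcongr

/-- At best, a separator isolates a vertex set of measure `β` with `β ^ r = 1 / 2` and keeps the
hyperedges inside this set and inside its complement. -/
theorem IsQuasirandom.le_ncard_of_isBalancedSeparator (h : IsQuasirandom H μ r δ) (hr : 2 ≤ r)
    {R : Set (Set α)} (hR : H.IsBalancedSeparator R) :
    (1 / 2 - separatorConst r - 2 * δ) * E(H).ncard ≤ R.ncard := by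
  have hcard : ((E(H) \ R).ncard : ℝ) + R.ncard = E(H).ncard := by
    exact_mod_cast Set.ncard_sdiff_add_ncard_of_subset hR.1
  linarith [h.ncard_sdiff_le_of_isBalancedSeparator hr hR]

end Quasirandom

section IidFamilies

variable {ι κ α : Type*} [Fintype ι] [Fintype κ] [MeasurableSpace α]

/-- The law of a family of independent points with common distribution `μ`, indexed by `ι`. The law
of a family of random `κ`-tuples is then `iidMeasure ι (iidMeasure κ ν)`. -/
noncomputable abbrev iidMeasure (ι : Type*) [Fintype ι] (μ : Measure α) : Measure (ι → α) :=
  Measure.pi fun _ => μ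

variable {μ : Measure α} [IsProbabilityMeasure μ]

theorem measureReal_iidMeasure_eval_preimage (i : ι) {s : Set α} (hs : MeasurableSet s) :
    (iidMeasure ι μ).real (Function.eval i ⁻¹' s) = μ.real s :=
  (measurePreserving_eval (fun _ : ι => μ) i).measureReal_preimage hs.nullMeasurableSet

theorem iIndepFun_eval_iidMeasure : iIndepFun (fun (i : ι) ω => ω i) (iidMeasure ι μ) :=
  iIndepFun_pi (X := fun _ => id) fun _ => aemeasurable_id

theorem measureReal_iidMeasure_prodMk_preimage_le {i j : ι} (hij : i ≠ j) {s : Set (α × α)}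
    (hs : MeasurableSet s) {c : ℝ} (hc : ∀ y, μ.real ((fun x => (x, y)) ⁻¹' s) ≤ c) :
    (iidMeasure ι μ).real ((fun ω => (ω i, ω j)) ⁻¹' s) ≤ c := by
  have hmap (l : ι) : (iidMeasure ι μ).map (fun ω => ω l) = μ :=
    (measurePreserving_eval (fun _ : ι => μ) l).map_eq
  have hlaw : (iidMeasure ι μ).map (fun ω => (ω i, ω j)) = μ.prod μ := by
    rw [(indepFun_iff_map_prod_eq_prod_map_map (measurable_pi_apply i).aemeasurable
      (measurable_pi_apply j).aemeasurable).1
      (iIndepFun_eval_iidMeasure.indepFun hij), hmap, hmap]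
  obtain ⟨x⟩ := nonempty_of_isProbabilityMeasure μ
  have hc0 : 0 ≤ c := measureReal_nonneg.trans (hc x)
  rw [← map_measureReal_apply (by fun_prop) hs, hlaw]
  refine ENNReal.toReal_le_of_le_ofReal hc0 ?_
  calc (μ.prod μ) s = ∫⁻ y, μ ((fun x => (x, y)) ⁻¹' s) ∂μ := Measure.prod_apply_symm hs
    _ ≤ ∫⁻ _, ENNReal.ofReal c ∂μ :=
        lintegral_mono fun y => (ENNReal.le_ofReal_iff_toReal_le (by finiteness) hc0).2 (hc y)
    _ = ENNReal.ofReal c := by rw [lintegral_const, measure_univ, mul_one]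

theorem ncard_setOf_mem_eq_sum_indicator {Ω : Type*} (A : ι → Set Ω) (ω : Ω) :
    ({i | ω ∈ A i}.ncard : ℝ) = ∑ i, (A i).indicator 1 ω := by
  classical
  simp [Set.indicator_apply, Set.ncard_eq_toFinset_card']

theorem measureReal_le_ncard_le_sum_div {Ω : Type*} [MeasurableSpace Ω] {P : Measure Ω}
    [IsFiniteMeasure P] {A : ι → Set Ω} (hA : ∀ i, MeasurableSet (A i)) {c : ℝ} (hc : 0 < c) :
    P.real {ω | c ≤ ({i | ω ∈ A i}.ncard : ℝ)} ≤ (∑ i, P.real (A i)) / c := by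
  have hint (i : ι) : Integrable ((A i).indicator (1 : Ω → ℝ)) P :=
    (integrable_const 1).indicator (hA i)
  have hmean : ∫ ω, ({i | ω ∈ A i}.ncard : ℝ) ∂P = ∑ i, P.real (A i) := by
    simp only [ncard_setOf_mem_eq_sum_indicator]
    rw [integral_finsetSum _ fun i _ => hint i]
    exact Finset.sum_congr rfl fun i _ => integral_indicator_one (hA i)
  rw [le_div_iff₀' hc, ← hmean]
  refine mul_meas_ge_le_integral_of_nonneg (ae_of_all _ fun ω => Nat.cast_nonneg _) ?_ c
  simp only [ncard_setOf_mem_eq_sum_indicator]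
  exact integrable_finsetSum _ fun i _ => hint i

theorem hasSubgaussianMGF_indicator_sub {s : Set α} (hs : MeasurableSet s) (i : ι) :
    HasSubgaussianMGF (fun ω => s.indicator 1 (ω i) - μ.real s) (1 / 4) (iidMeasure ι μ) := by
  have hmean : ∫ ω, s.indicator (1 : α → ℝ) (ω i) ∂iidMeasure ι μ = μ.real s := by
    rw [integral_comp_eval (measurable_one.indicator hs).aestronglyMeasurable,
      integral_indicator_one hs]
  have h := hasSubgaussianMGF_of_mem_Icc (μ := iidMeasure ι μ) (a := 0) (b := 1)
    (X := fun ω => s.indicator (1 : α → ℝ) (ω i))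
    ((measurable_one.indicator hs).comp (measurable_pi_apply i)).aemeasurable
    (ae_of_all _ fun ω => ⟨Set.indicator_nonneg (fun _ _ => zero_le_one) _,
      Set.indicator_le_self' (fun _ _ => zero_le_one) _⟩)
  rw [hmean] at h
  convert h using 1
  norm_num

theorem measureReal_iidMeasure_add_le_ncard_le_exp {s : Set α} (hs : MeasurableSet s) {δ : ℝ}
    (hδ : 0 ≤ δ) :
    (iidMeasure ι μ).real
        {ω | (μ.real s + δ) * Fintype.card ι ≤ ({i | ω i ∈ s}.ncard : ℝ)} ≤
      Real.exp (-2 * δ ^ 2 * Fintype.card ι) := by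
  have hindep : iIndepFun (fun (i : ι) ω => s.indicator 1 (ω i) - μ.real s) (iidMeasure ι μ) :=
    iIndepFun_pi (X := fun _ x => s.indicator 1 x - μ.real s) fun _ =>
      ((measurable_one.indicator hs).sub_const (μ.real s)).aemeasurable
  have hsum (ω : ι → α) : ∑ i, (s.indicator 1 (ω i) - μ.real s) =
      ({i | ω i ∈ s}.ncard : ℝ) - μ.real s * Fintype.card ι := by
    rw [Finset.sum_sub_distrib, Finset.sum_const, Finset.card_univ, nsmul_eq_mul, mul_comm]
    exact congrArg (· - _)
      (ncard_setOf_mem_eq_sum_indicator (fun i => Function.eval i ⁻¹' s) ω).symm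
  have hexponent : -(δ * Fintype.card ι) ^ 2 / (2 * ((∑ _i : ι, (1 / 4) : NNReal) : ℝ)) =
      -2 * δ ^ 2 * Fintype.card ι := by
    rw [Finset.sum_const, Finset.card_univ, nsmul_eq_mul]
    push_cast
    rcases eq_or_ne (Fintype.card ι : ℝ) 0 with h | h
    · rw [h]; ring
    · field_simp; ring
  have h := HasSubgaussianMGF.measure_sum_ge_le_of_iIndepFun hindep (s := Finset.univ)
    (fun i _ => hasSubgaussianMGF_indicator_sub hs i) (ε := δ * Fintype.card ι) (by positivity)
  rw [hexponent] at h
  simpa only [hsum, le_sub_iff_add_le', ← add_mul] using h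

end IidFamilies

section RandomTuples

theorem measureReal_setOf_exists_le {Ω β : Type*} [MeasurableSpace Ω] {P : Measure Ω}
    [Fintype β] {q : β → Ω → Prop} {c : ℝ} (hq : ∀ b, P.real {ω | q b ω} ≤ c) :
    P.real {ω | ∃ b, q b ω} ≤ Fintype.card β * c := by
  rw [Set.ofPred_exists, ← nsmul_eq_mul]
  exact (measureReal_iUnion_fintype_le _).trans (Finset.sum_le_card_nsmul _ _ _ fun b _ => hq b)

theorem measureReal_setOf_and_le {Ω : Type*} [MeasurableSpace Ω] {P : Measure Ω} {q : Prop}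
    {s : Ω → Prop} {c : ℝ} (hc : 0 ≤ c) (hs : q → P.real {ω | s ω} ≤ c) :
    P.real {ω | q ∧ s ω} ≤ c := by
  by_cases hq : q
  · simpa only [hq, true_and] using hs hq
  · simpa only [hq, false_and, Set.ofPred_false, measureReal_empty] using hc

theorem exists_notMem_notMem_of_measureReal_add_lt_one {Ω : Type*} [MeasurableSpace Ω]
    {P : Measure Ω} [IsProbabilityMeasure P] {s t : Set Ω} (h : P.real s + P.real t < 1) :
    ∃ ω, ω ∉ s ∧ ω ∉ t := by
  by_contra! hcover
  have huniv : s ∪ t = Set.univ := Set.eq_univ_of_forall fun ω => or_iff_not_imp_left.2 (hcover ω)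
  have hunion := measureReal_union_le (μ := P) s t
  rw [huniv, probReal_univ] at hunion
  linarith

/-- A tuple that prevents the ranges of the tuples of `ω` from being the hyperedges of a uniform
hypergraph of maximum degree at most `k`: it has a repeated entry, its range is contained in that of
another tuple, or one of its entries is shared with at least `k` other tuples. -/
def IsBadTuple {ι κ V : Type*} (k : ℕ) (ω : ι → κ → V) (i : ι) : Prop :=
  ¬ Function.Injective (ω i) ∨ (∃ j, j ≠ i ∧ Set.range (ω i) ⊆ Set.range (ω j)) ∨
    ∃ a, k ≤ {j | j ≠ i ∧ ω i a ∈ Set.range (ω j)}.ncard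

variable {κ V : Type*} [Fintype κ] [MeasurableSpace V] {ν : Measure V} {p : ℝ}

theorem measureReal_range_le (hp : ∀ v, ν.real {v} ≤ p) (t : κ → V) :
    ν.real (Set.range t) ≤ Fintype.card κ * p := by
  have hrange : Set.range t = {v | ∃ a, v ∈ ({t a} : Set V)} := by
    ext v
    simp only [Set.mem_range, Set.mem_ofPred_eq, Set.mem_singleton_iff, eq_comm]
  rw [hrange]
  exact measureReal_setOf_exists_le fun a => hp (t a)

variable [IsProbabilityMeasure ν]

theorem measureReal_iidMeasure_range_subset (S : Set V) :
    (iidMeasure κ ν).real {t | Set.range t ⊆ S} = ν.real S ^ Fintype.card κ := by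
  have hpi : {t : κ → V | Set.range t ⊆ S} = Set.univ.pi fun _ => S := by
    ext t
    simp only [Set.mem_ofPred_eq, Set.range_subset_iff, Set.mem_univ_pi]
  rw [hpi, measureReal_def, Measure.pi_pi, Finset.prod_const, Finset.card_univ,
    ENNReal.toReal_pow, measureReal_def]

variable [Finite V] [MeasurableSingletonClass V]

theorem measureReal_iidMeasure_eval_eq_eval_le (hp : ∀ v, ν.real {v} ≤ p) {a b : κ}
    (hab : a ≠ b) : (iidMeasure κ ν).real {t | t a = t b} ≤ p :=
  measureReal_iidMeasure_prodMk_preimage_le hab (s := {x | x.1 = x.2}) .of_discrete hp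

theorem measureReal_iidMeasure_not_injective_le (hp : ∀ v, ν.real {v} ≤ p) :
    (iidMeasure κ ν).real {t | ¬ Function.Injective t} ≤ Fintype.card κ ^ 2 * p := by
  obtain ⟨v⟩ := nonempty_of_isProbabilityMeasure ν
  have hpair (x : κ × κ) : (iidMeasure κ ν).real {t | x.1 ≠ x.2 ∧ t x.1 = t x.2} ≤ p :=
    measureReal_setOf_and_le (measureReal_nonneg.trans (hp v))
      (measureReal_iidMeasure_eval_eq_eval_le hp)
  simpa only [Function.not_injective_iff, Prod.exists, and_comm, Fintype.card_prod, Nat.cast_mul,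
    sq] using measureReal_setOf_exists_le hpair

variable {ι : Type*} [Fintype ι] {i j : ι}

theorem measureReal_iidMeasure_mem_range_le (hp : ∀ v, ν.real {v} ≤ p) (hij : i ≠ j) (a : κ) :
    (iidMeasure ι (iidMeasure κ ν)).real {ω | ω i a ∈ Set.range (ω j)} ≤ Fintype.card κ * p := by
  refine measureReal_iidMeasure_prodMk_preimage_le hij (s := {x | x.1 a ∈ Set.range x.2})
    .of_discrete fun t => ?_
  exact (measureReal_iidMeasure_eval_preimage a .of_discrete).trans_le (measureReal_range_le hp t)

theorem measureReal_iidMeasure_range_subset_range_le (hp : ∀ v, ν.real {v} ≤ p)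
    (hκ : 2 ≤ Fintype.card κ) (hij : i ≠ j) :
    (iidMeasure ι (iidMeasure κ ν)).real {ω | Set.range (ω i) ⊆ Set.range (ω j)} ≤
      (Fintype.card κ * p) ^ 2 := by
  refine measureReal_iidMeasure_prodMk_preimage_le hij
    (s := {x | Set.range x.1 ⊆ Set.range x.2}) .of_discrete fun t => ?_
  calc (iidMeasure κ ν).real {u | Set.range u ⊆ Set.range t}
      = ν.real (Set.range t) ^ Fintype.card κ := measureReal_iidMeasure_range_subset _
    _ ≤ ν.real (Set.range t) ^ 2 :=
        pow_le_pow_of_le_one measureReal_nonneg measureReal_le_one hκ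
    _ ≤ (Fintype.card κ * p) ^ 2 :=
        pow_le_pow_left₀ measureReal_nonneg (measureReal_range_le hp t) 2

theorem measureReal_le_ncard_mem_range_le (hp : ∀ v, ν.real {v} ≤ p) {k : ℕ} (hk : 0 < k) (i : ι)
    (a : κ) :
    (iidMeasure ι (iidMeasure κ ν)).real
        {ω | k ≤ {j | j ≠ i ∧ ω i a ∈ Set.range (ω j)}.ncard} ≤
      Fintype.card ι * (Fintype.card κ * p) / k := by
  obtain ⟨t⟩ := nonempty_of_isProbabilityMeasure (iidMeasure κ ν)
  have hle (j : ι) : (iidMeasure ι (iidMeasure κ ν)).real {ω | j ≠ i ∧ ω i a ∈ Set.range (ω j)} ≤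
      Fintype.card κ * p :=
    measureReal_setOf_and_le (measureReal_nonneg.trans (measureReal_range_le hp t))
      fun hij => measureReal_iidMeasure_mem_range_le hp hij.symm a
  have hmarkov := measureReal_le_ncard_le_sum_div (P := iidMeasure ι (iidMeasure κ ν))
    (A := fun j => {ω | j ≠ i ∧ ω i a ∈ Set.range (ω j)}) (fun _ => .of_discrete)
    (c := k) (by positivity)
  simp only [Nat.cast_le] at hmarkov
  refine hmarkov.trans (div_le_div_of_nonneg_right ?_ k.cast_nonneg)
  rw [← nsmul_eq_mul]
  exact Finset.sum_le_card_nsmul _ _ _ fun j _ => hle j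

theorem measureReal_isBadTuple_le (hp : ∀ v, ν.real {v} ≤ p) (hκ : 2 ≤ Fintype.card κ) {k : ℕ}
    (hk : 0 < k) (i : ι) :
    (iidMeasure ι (iidMeasure κ ν)).real {ω | IsBadTuple k ω i} ≤
      Fintype.card κ ^ 2 * (p + Fintype.card ι * p ^ 2 + Fintype.card ι * p / k) := by
  set P := iidMeasure ι (iidMeasure κ ν)
  have hnot_injective : P.real {ω | ¬ Function.Injective (ω i)} ≤ Fintype.card κ ^ 2 * p :=
    (measureReal_iidMeasure_eval_preimage i .of_discrete).trans_le
      (measureReal_iidMeasure_not_injective_le hp)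
  have hsubset : P.real {ω | ∃ j, j ≠ i ∧ Set.range (ω i) ⊆ Set.range (ω j)} ≤
      Fintype.card ι * (Fintype.card κ * p) ^ 2 :=
    measureReal_setOf_exists_le fun j => measureReal_setOf_and_le (sq_nonneg _) fun hij =>
      measureReal_iidMeasure_range_subset_range_le hp hκ hij.symm
  have hshared : P.real {ω | ∃ a, k ≤ {j | j ≠ i ∧ ω i a ∈ Set.range (ω j)}.ncard} ≤
      Fintype.card κ * (Fintype.card ι * (Fintype.card κ * p) / k) :=
    measureReal_setOf_exists_le (measureReal_le_ncard_mem_range_le hp hk i)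
  calc P.real {ω | IsBadTuple k ω i}
      ≤ Fintype.card κ ^ 2 * p + (Fintype.card ι * (Fintype.card κ * p) ^ 2 +
          Fintype.card κ * (Fintype.card ι * (Fintype.card κ * p) / k)) :=
        (measureReal_union_le _ _).trans (add_le_add hnot_injective
          ((measureReal_union_le _ _).trans (add_le_add hsubset hshared)))
    _ = Fintype.card κ ^ 2 * (p + Fintype.card ι * p ^ 2 + Fintype.card ι * p / k) := by ring

theorem measureReal_le_ncard_isBadTuple_le_half [Nonempty ι] {k : ℕ} {b : ℝ} (hb : 0 < b)
    (hbad : ∀ i, (iidMeasure ι (iidMeasure κ ν)).real {ω | IsBadTuple k ω i} ≤ b) :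
    (iidMeasure ι (iidMeasure κ ν)).real
      {ω | 2 * b * Fintype.card ι ≤ ({i | IsBadTuple k ω i}.ncard : ℝ)} ≤ 1 / 2 := by
  refine (measureReal_le_ncard_le_sum_div (A := fun i => {ω | IsBadTuple k ω i})
    (fun _ => .of_discrete) (by positivity)).trans ?_
  rw [div_le_iff₀ (by positivity)]
  calc ∑ i, (iidMeasure ι (iidMeasure κ ν)).real {ω | IsBadTuple k ω i}
      ≤ Fintype.card ι * b := by
        rw [← nsmul_eq_mul]
        exact Finset.sum_le_card_nsmul _ _ _ fun i _ => hbad i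
    _ = 1 / 2 * (2 * b * Fintype.card ι) := by ring

theorem measureReal_exists_add_le_ncard_range_subset_le {δ : ℝ} (hδ : 0 ≤ δ) :
    (iidMeasure ι (iidMeasure κ ν)).real
        {ω | ∃ S : Set V, (ν.real S ^ Fintype.card κ + δ) * Fintype.card ι ≤
          ({i | Set.range (ω i) ⊆ S}.ncard : ℝ)} ≤
      2 ^ Nat.card V * Real.exp (-2 * δ ^ 2 * Fintype.card ι) := by
  have := Fintype.ofFinite V
  have hcard : (2 : ℝ) ^ Nat.card V = Fintype.card (Set V) := by
    rw [Fintype.card_set, Nat.card_eq_fintype_card, Nat.cast_pow, Nat.cast_ofNat]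
  rw [hcard]
  refine measureReal_setOf_exists_le fun S => ?_
  rw [← measureReal_iidMeasure_range_subset]
  exact measureReal_iidMeasure_add_le_ncard_le_exp .of_discrete hδ

theorem two_pow_mul_exp_lt_half {n : ℕ} {x : ℝ} (hx : n + 1 ≤ x) :
    2 ^ n * Real.exp (-2 * x) < 1 / 2 := by
  have htwo : (2 : ℝ) < Real.exp 1 := by linarith [Real.exp_one_gt_d9]
  calc 2 ^ n * Real.exp (-2 * x) ≤ Real.exp 1 ^ n * Real.exp (-2 * x) := by gcongr
    _ = Real.exp (n - 2 * x) := by rw [← Real.exp_nat_mul, ← Real.exp_add]; ring_nf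
    _ ≤ Real.exp (-1) := Real.exp_le_exp.2 (by linarith [n.cast_nonneg (α := ℝ)])
    _ < 1 / 2 := by
      rw [Real.exp_neg, one_div]
      exact inv_strictAnti₀ two_pos htwo

theorem exists_ncard_isBadTuple_le_and_ncard_range_subset_le [Nonempty ι] {k : ℕ} {b δ : ℝ}
    (hb : 0 < b) (hbad : ∀ i, (iidMeasure ι (iidMeasure κ ν)).real {ω | IsBadTuple k ω i} ≤ b)
    (hδ : 0 ≤ δ) (hcard : Nat.card V + 1 ≤ δ ^ 2 * Fintype.card ι) :
    ∃ ω : ι → κ → V, {i | IsBadTuple k ω i}.ncard ≤ 2 * b * Fintype.card ι ∧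
      ∀ S, ({i | Set.range (ω i) ⊆ S}.ncard : ℝ) ≤
        (ν.real S ^ Fintype.card κ + δ) * Fintype.card ι := by
  have hmany := measureReal_le_ncard_isBadTuple_le_half hb hbad
  have hcrowded := (measureReal_exists_add_le_ncard_range_subset_le (κ := κ) (ι := ι) (ν := ν)
    hδ).trans_lt (mul_assoc (-2) (δ ^ 2) _ ▸ two_pow_mul_exp_lt_half hcard)
  obtain ⟨ω, hω_many, hω_crowded⟩ :=
    exists_notMem_notMem_of_measureReal_add_lt_one
      ((add_lt_add_of_le_of_lt hmany hcrowded).trans_eq (add_halves 1))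
  simp only [Set.mem_ofPred_eq, not_exists, not_le] at hω_many hω_crowded
  exact ⟨ω, hω_many.le, fun S => (hω_crowded S).le⟩

end RandomTuples

section TupleHypergraphs

/-- The hypergraph whose hyperedges are the ranges of the tuples of a family. -/
def tupleHypergraph {ι κ V : Type*} (G : ι → κ → V) : Hypergraph V where
  vertexSet := Set.univ
  edgeSet := Set.range fun i => Set.range (G i)
  subset_vertexSet_of_mem_edgeSet' := fun _ _ => Set.subset_univ _

open Classical in
/-- The tuples of `ω`, where each bad tuple is replaced by a tuple of new vertices. -/
noncomputable def repairedTuple {ι κ V : Type*} (k : ℕ) (ω : ι → κ → V) (i : ι) (a : κ) :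
    V ⊕ ι × κ :=
  if IsBadTuple k ω i then Sum.inr (i, a) else Sum.inl (ω i a)

variable {ι κ V W : Type*}

theorem isUniform_tupleHypergraph {G : ι → κ → V} (hG : ∀ i, Function.Injective (G i)) :
    (tupleHypergraph G).IsUniform (Nat.card κ) := by
  rintro _ ⟨i, rfl⟩
  exact (Nat.card_coe_set_eq _).symm.trans (Nat.card_range_of_injective (hG i))

theorem ncard_edgeSet_tupleHypergraph {G : ι → κ → V}
    (hG : Function.Injective fun i => Set.range (G i)) :
    E(tupleHypergraph G).ncard = Nat.card ι :=
  (Nat.card_coe_set_eq _).symm.trans (Nat.card_range_of_injective hG)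

theorem ncard_sep_edgeSet_tupleHypergraph_le [Finite ι] (G : ι → κ → V) (q : Set V → Prop) :
    {e ∈ E(tupleHypergraph G) | q e}.ncard ≤ {i | q (Set.range (G i))}.ncard := by
  have himage : {e ∈ E(tupleHypergraph G) | q e} ⊆
      (fun i => Set.range (G i)) '' {i | q (Set.range (G i))} := by
    rintro _ ⟨⟨i, rfl⟩, hq⟩
    exact ⟨i, hq, rfl⟩
  exact (Set.ncard_le_ncard himage (Set.toFinite _)).trans (Set.ncard_image_le (Set.toFinite _))

theorem maxDegree_tupleHypergraph_le [Finite ι] [Fintype V] {G : ι → κ → V} {k : ℕ}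
    (hG : ∀ v, {i | v ∈ Set.range (G i)}.ncard ≤ k) : (tupleHypergraph G).maxDegree ≤ k :=
  Finset.sup_le fun v _ => (ncard_sep_edgeSet_tupleHypergraph_le G fun e => v ∈ e).trans (hG v)

variable {k : ℕ} {ω : ι → κ → V}

theorem inl_mem_range_repairedTuple_iff {i : ι} {x : V} :
    Sum.inl x ∈ Set.range (repairedTuple k ω i) ↔ ¬ IsBadTuple k ω i ∧ x ∈ Set.range (ω i) := by
  by_cases h : IsBadTuple k ω i <;> simp [repairedTuple, h]

theorem inr_mem_range_repairedTuple_iff {i j : ι} {a : κ} :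
    Sum.inr (j, a) ∈ Set.range (repairedTuple k ω i) ↔ IsBadTuple k ω i ∧ i = j := by
  by_cases h : IsBadTuple k ω i <;> simp [repairedTuple, h]

variable (k ω)

theorem repairedTuple_injective (i : ι) : Function.Injective (repairedTuple k ω i) := by
  by_cases h : IsBadTuple k ω i
  · have heq : repairedTuple k ω i = fun a => Sum.inr (i, a) := funext fun a => if_pos h
    exact heq ▸ Sum.inr_injective.comp (Prod.mk_right_injective i)
  · have heq : repairedTuple k ω i = fun a => Sum.inl (ω i a) := funext fun a => if_neg h
    exact heq ▸ Sum.inl_injective.comp (not_not.1 fun h' => h (Or.inl h'))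

theorem range_repairedTuple_injective [Nonempty κ] :
    Function.Injective fun i => Set.range (repairedTuple k ω i) := by
  intro i j hij
  have hmem (v : V ⊕ ι × κ) :
      v ∈ Set.range (repairedTuple k ω i) ↔ v ∈ Set.range (repairedTuple k ω j) :=
    Set.ext_iff.1 hij v
  obtain ⟨a⟩ := ‹Nonempty κ›
  by_cases hi : IsBadTuple k ω i
  · have h := (hmem (Sum.inr (i, a))).1 (inr_mem_range_repairedTuple_iff.2 ⟨hi, rfl⟩)
    exact (inr_mem_range_repairedTuple_iff.1 h).2.symm
  · by_contra hne
    refine hi (Or.inr (Or.inl ⟨j, Ne.symm hne, fun x hx => ?_⟩))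
    have h := (hmem (Sum.inl x)).1 (inl_mem_range_repairedTuple_iff.2 ⟨hi, hx⟩)
    exact (inl_mem_range_repairedTuple_iff.1 h).2

theorem ncard_mem_range_repairedTuple_le [Finite ι] (hk : 0 < k) (v : V ⊕ ι × κ) :
    {i | v ∈ Set.range (repairedTuple k ω i)}.ncard ≤ k := by
  rcases v with x | ⟨j, a⟩
  · simp only [inl_mem_range_repairedTuple_iff]
    rcases Set.eq_empty_or_nonempty {i | ¬ IsBadTuple k ω i ∧ x ∈ Set.range (ω i)} with
      hempty | ⟨i, hi, a, rfl⟩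
    · rw [hempty, Set.ncard_empty]
      exact hk.le
    have hshared : {j | j ≠ i ∧ ω i a ∈ Set.range (ω j)}.ncard < k := by
      by_contra! h
      exact hi (Or.inr (Or.inr ⟨a, h⟩))
    have hsub : {j | ¬ IsBadTuple k ω j ∧ ω i a ∈ Set.range (ω j)} ⊆
        insert i {j | j ≠ i ∧ ω i a ∈ Set.range (ω j)} :=
      fun j hj => or_iff_not_imp_left.2 fun hji => ⟨hji, hj.2⟩
    exact (Set.ncard_le_ncard hsub (Set.toFinite _)).trans
      ((Set.ncard_insert_le _ _).trans hshared)
  · have hsub : {i | Sum.inr (j, a) ∈ Set.range (repairedTuple k ω i)} ⊆ {j} :=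
      fun i hi => (inr_mem_range_repairedTuple_iff.1 hi).2
    exact (Set.ncard_le_ncard hsub).trans ((Set.ncard_singleton j).trans_le hk)

theorem ncard_range_repairedTuple_subset_le [Finite ι] (S : Set (V ⊕ ι × κ)) :
    {i | Set.range (repairedTuple k ω i) ⊆ S}.ncard ≤
      {i | Set.range (ω i) ⊆ Sum.inl ⁻¹' S}.ncard + {i | IsBadTuple k ω i}.ncard := by
  refine (Set.ncard_le_ncard (fun i hi => ?_) (Set.toFinite _)).trans (Set.ncard_union_le _ _)
  exact or_iff_not_imp_right.2 fun h x hx => hi (inl_mem_range_repairedTuple_iff.2 ⟨h, hx⟩)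

/-- The hypergraph of the ranges of the repaired tuples, on a vertex type `W` that has room for the
original and the new vertices. -/
noncomputable def repairedHypergraph (e : V ⊕ ι × κ ≃ W) : Hypergraph W :=
  tupleHypergraph fun i => e ∘ repairedTuple k ω i

variable (e : V ⊕ ι × κ ≃ W)

theorem isUniform_repairedHypergraph :
    (repairedHypergraph k ω e).IsUniform (Nat.card κ) :=
  isUniform_tupleHypergraph fun i => e.injective.comp (repairedTuple_injective k ω i)

theorem ncard_edgeSet_repairedHypergraph [Nonempty κ] :
    E(repairedHypergraph k ω e).ncard = Nat.card ι := by
  refine ncard_edgeSet_tupleHypergraph ?_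
  simp only [Set.range_comp]
  exact e.injective.image_injective.comp (range_repairedTuple_injective k ω)

theorem maxDegree_repairedHypergraph_le [Finite ι] [Fintype W] (hk : 0 < k) :
    (repairedHypergraph k ω e).maxDegree ≤ k := by
  refine maxDegree_tupleHypergraph_le fun v => ?_
  simp only [Set.range_comp, Set.mem_image_equiv]
  exact ncard_mem_range_repairedTuple_le k ω hk (e.symm v)

theorem isQuasirandom_repairedHypergraph [Finite ι] [Nonempty κ] [MeasurableSpace V]
    [DiscreteMeasurableSpace V] [MeasurableSpace W] [DiscreteMeasurableSpace W] {ν : Measure V}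
    {r : ℕ} {δ η : ℝ}
    (hω : ∀ S, ({i | Set.range (ω i) ⊆ S}.ncard : ℝ) ≤ (ν.real S ^ r + δ) * Nat.card ι)
    (hbad : ({i | IsBadTuple k ω i}.ncard : ℝ) ≤ η * Nat.card ι) :
    IsQuasirandom (repairedHypergraph k ω e) (ν.map (e ∘ Sum.inl)) r (δ + η) := by
  intro S
  rw [ncard_edgeSet_repairedHypergraph, map_measureReal_apply .of_discrete .of_discrete,
    Set.preimage_comp]
  calc ({s ∈ E(repairedHypergraph k ω e) | s ⊆ S}.ncard : ℝ)
      ≤ {i | Set.range (e ∘ repairedTuple k ω i) ⊆ S}.ncard := by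
        exact_mod_cast ncard_sep_edgeSet_tupleHypergraph_le _ fun s => s ⊆ S
    _ = {i | Set.range (repairedTuple k ω i) ⊆ e ⁻¹' S}.ncard := by
        simp only [Set.range_comp, Set.image_subset_iff]
    _ ≤ {i | Set.range (ω i) ⊆ Sum.inl ⁻¹' (e ⁻¹' S)}.ncard + {i | IsBadTuple k ω i}.ncard := by
        exact_mod_cast ncard_range_repairedTuple_subset_le k ω (e ⁻¹' S)
    _ ≤ (ν.real (Sum.inl ⁻¹' (e ⁻¹' S)) ^ r + (δ + η)) * Nat.card ι := by
        linarith [hω (Sum.inl ⁻¹' (e ⁻¹' S))]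

end TupleHypergraphs

section HardHypergraphs

/-- There is a finite `r`-uniform hypergraph with `m` hyperedges and maximum degree at most `k`, all
of whose balanced separators have at least `b` hyperedges. -/
def ExistsHardHypergraph (r k m : ℕ) (b : ℝ) : Prop :=
  ∃ (n : ℕ) (H : Hypergraph (Fin n)), H.IsUniform r ∧ E(H).ncard = m ∧ H.maxDegree ≤ k ∧
    ∀ R, H.IsBalancedSeparator R → b ≤ R.ncard

theorem ExistsHardHypergraph.mono {r k k' m : ℕ} {b b' : ℝ} (h : ExistsHardHypergraph r k m b)
    (hk : k ≤ k') (hb : b' ≤ b) : ExistsHardHypergraph r k' m b' := by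
  obtain ⟨n, H, hH, hE, hdeg, hsep⟩ := h
  exact ⟨n, H, hH, hE, hdeg.trans hk, fun R hR => hb.trans (hsep R hR)⟩

theorem existsHardHypergraph_zero (r k : ℕ) {b : ℝ} (hb : b ≤ 0) :
    ExistsHardHypergraph r k 0 b := by
  let G : Fin 0 → Fin r → Fin 0 := finZeroElim
  refine ⟨0, tupleHypergraph G, ?_, ?_, maxDegree_tupleHypergraph_le finZeroElim,
    fun R _ => hb.trans R.ncard.cast_nonneg⟩
  · simpa only [Nat.card_fin] using isUniform_tupleHypergraph (G := G) finZeroElim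
  · rw [ncard_edgeSet_tupleHypergraph (Function.injective_of_subsingleton _), Nat.card_fin]

theorem existsHardHypergraph_of_measureReal_singleton_le {r k m : ℕ} (hr : 2 ≤ r) (hk : 0 < k)
    (hm : 0 < m) {V : Type*} [Finite V] [MeasurableSpace V] [MeasurableSingletonClass V]
    {ν : Measure V} [IsProbabilityMeasure ν] {p : ℝ} (hp : ∀ v, ν.real {v} ≤ p) {b : ℝ} (hb : 0 < b)
    (hpb : r ^ 2 * (p + m * p ^ 2 + m * p / k) ≤ b) {δ : ℝ} (hδ : 0 ≤ δ)
    (hδm : Nat.card V + 1 ≤ δ ^ 2 * m) :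
    ExistsHardHypergraph r k m ((1 / 2 - separatorConst r - 2 * (δ + 2 * b)) * m) := by
  have : Nonempty (Fin m) := ⟨⟨0, hm⟩⟩
  have : Nonempty (Fin r) := ⟨⟨0, by lia⟩⟩
  have := Fintype.ofFinite V
  have hbad (i : Fin m) :
      (iidMeasure (Fin m) (iidMeasure (Fin r) ν)).real {ω | IsBadTuple k ω i} ≤ b := by
    refine (measureReal_isBadTuple_le hp (by rwa [Fintype.card_fin]) hk i).trans ?_
    rwa [Fintype.card_fin, Fintype.card_fin]
  obtain ⟨ω, hω_bad, hω⟩ := exists_ncard_isBadTuple_le_and_ncard_range_subset_le hb hbad hδ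
    (by rwa [Fintype.card_fin])
  let e := Fintype.equivFin (V ⊕ Fin m × Fin r)
  have : IsProbabilityMeasure (ν.map (e ∘ Sum.inl)) :=
    Measure.isProbabilityMeasure_map (Measurable.of_discrete).aemeasurable
  have hE := ncard_edgeSet_repairedHypergraph k ω e
  have hquasirandom :
      IsQuasirandom (repairedHypergraph k ω e) (ν.map (e ∘ Sum.inl)) r (δ + 2 * b) :=
    isQuasirandom_repairedHypergraph k ω e (by simpa using hω) (by simpa using hω_bad)
  rw [Nat.card_fin] at hE
  refine ⟨_, repairedHypergraph k ω e, ?_, hE, maxDegree_repairedHypergraph_le k ω e hk,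
    fun R hR => ?_⟩
  · simpa only [Nat.card_fin] using isUniform_repairedHypergraph k ω e
  · simpa only [hE] using hquasirandom.le_ncard_of_isBalancedSeparator hr hR

theorem existsHardHypergraph_of_card {r k m n : ℕ} (hr : 2 ≤ r) (hk : 0 < k) (hm : 0 < m)
    (hn : 0 < n) :
    ExistsHardHypergraph r k m ((1 / 2 - separatorConst r -
      2 * (√((n + 1) / m) + 2 * (r ^ 2 * (1 / n + m / n ^ 2 + m / (n * k))))) * m) := by
  have : Nonempty (Fin n) := ⟨⟨0, hn⟩⟩
  have : IsProbabilityMeasure (uniformOn (Set.univ : Set (Fin n))) :=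
    isProbabilityMeasure_uniformOn Set.finite_univ Set.univ_nonempty
  refine existsHardHypergraph_of_measureReal_singleton_le
    (ν := uniformOn (Set.univ : Set (Fin n))) (p := 1 / n) hr hk hm (fun v => ?_) (by positivity)
    (le_of_eq (by field_simp)) (Real.sqrt_nonneg _) ?_
  · simp [uniformOn_univ, measureReal_def]
  · rw [Real.sq_sqrt (by positivity), div_mul_cancel₀ _ (by positivity), Nat.card_fin]

theorem one_div_add_div_sq_add_div_mul_le {q k m n : ℝ} (hq : 1 ≤ q) (hk : q ^ 2 ≤ k)
    (hm : q ^ 4 ≤ m) (hn : m / q ≤ n) : 1 / n + m / n ^ 2 + m / (n * k) ≤ 3 / q := by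
  have hq0 : 0 < q := by linarith
  have hm0 : 0 < m := (by positivity : 0 < q ^ 4).trans_le hm
  have hn0 : 0 < n := (by positivity : 0 < m / q).trans_le hn
  have hk0 : 0 < k := (by positivity : 0 < q ^ 2).trans_le hk
  have hmn : m / n ≤ q := by rwa [div_le_comm₀ hn0 hq0]
  have hn_ge : q ^ 3 ≤ n := by
    refine le_trans ?_ hn
    rw [le_div_iff₀ hq0]
    linarith
  have hfirst : 1 / n ≤ 1 / q :=
    one_div_le_one_div_of_le hq0 ((le_self_pow₀ hq (by norm_num)).trans hn_ge)
  have hsecond : m / n ^ 2 ≤ 1 / q :=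
    calc m / n ^ 2 = m / n * (1 / n) := by field_simp
      _ ≤ q * (1 / q ^ 3) := by gcongr
      _ = 1 / q ^ 2 := by field_simp
      _ ≤ 1 / q := one_div_le_one_div_of_le hq0 (le_self_pow₀ hq (by norm_num))
  have hthird : m / (n * k) ≤ 1 / q :=
    calc m / (n * k) = m / n * (1 / k) := by ring
      _ ≤ q * (1 / q ^ 2) := by gcongr
      _ = 1 / q := by field_simp
  calc 1 / n + m / n ^ 2 + m / (n * k) ≤ 1 / q + 1 / q + 1 / q := by gcongr
    _ = 3 / q := by ring

theorem sqrt_add_one_div_le {q m n : ℝ} (hq : 1 ≤ q) (hm : q ^ 4 ≤ m) (hn : n ≤ m / q + 1) :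
    √((n + 1) / m) ≤ 2 / √q := by
  have hq0 : 0 < q := by linarith
  have hqm : q ≤ m := (le_self_pow₀ hq (by norm_num)).trans hm
  have hm0 : 0 < m := hq0.trans_le hqm
  refine Real.sqrt_le_iff.2 ⟨by positivity, ?_⟩
  calc (n + 1) / m ≤ (m / q + 1 + 1) / m := by gcongr
    _ = 1 / q + 2 / m := by field_simp; ring
    _ ≤ 1 / q + 2 / q := by gcongr
    _ ≤ 4 / q := by rw [← add_div]; gcongr; norm_num
    _ = (2 / √q) ^ 2 := by rw [div_pow, Real.sq_sqrt hq0.le]; norm_num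

theorem sqrt_add_one_div_add_le {q k m n c : ℝ} (hq : 1 ≤ q) (hk : q ^ 2 ≤ k) (hm : q ^ 4 ≤ m)
    (hn : m / q ≤ n) (hn' : n ≤ m / q + 1) (hc : 0 ≤ c) :
    √((n + 1) / m) + 2 * (c * (1 / n + m / n ^ 2 + m / (n * k))) ≤ (2 + 6 * c) / √q :=
  calc √((n + 1) / m) + 2 * (c * (1 / n + m / n ^ 2 + m / (n * k)))
      ≤ 2 / √q + 2 * (c * (3 / q)) := by
        gcongr
        · exact sqrt_add_one_div_le hq hm hn'
        · exact one_div_add_div_sq_add_div_mul_le hq hk hm hn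
    _ = 2 / √q + 6 * c * (1 / q) := by ring
    _ ≤ 2 / √q + 6 * c * (1 / √q) := by
        gcongr
        exact Real.sqrt_le_self_iff.2 (Or.inr hq)
    _ = (2 + 6 * c) / √q := by ring

theorem exists_forall_existsHardHypergraph {r : ℕ} (hr : 2 ≤ r) :
    ∃ A : ℝ, ∀ q k m : ℕ, 0 < q → q ^ 2 ≤ k → q ^ 4 ≤ m →
      ExistsHardHypergraph r k m ((1 / 2 - separatorConst r) * m * (1 - A / √q)) := by
  have hc : 0 < 1 / 2 - separatorConst r := sub_pos.2 (separatorConst_lt_half hr)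
  refine ⟨2 * (2 + 6 * r ^ 2) / (1 / 2 - separatorConst r), fun q k m hq hqk hqm => ?_⟩
  have hk : 0 < k := (by positivity : 0 < q ^ 2).trans_le hqk
  have hm : 0 < m := (by positivity : 0 < q ^ 4).trans_le hqm
  obtain ⟨n, hn, hn_ge, hn_le⟩ : ∃ n : ℕ, 0 < n ∧ (m : ℝ) / q ≤ n ∧ (n : ℝ) ≤ m / q + 1 :=
    ⟨⌈(m : ℝ) / q⌉₊, Nat.ceil_pos.2 (by positivity), Nat.le_ceil _,
      (Nat.ceil_lt_add_one (by positivity)).le⟩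
  have herror := sqrt_add_one_div_add_le (k := k) (c := r ^ 2) (by exact_mod_cast hq)
    (by exact_mod_cast hqk) (by exact_mod_cast hqm) hn_ge hn_le (by positivity)
  refine (existsHardHypergraph_of_card hr hk hm hn).mono le_rfl ?_
  calc (1 / 2 - separatorConst r) * m *
        (1 - 2 * (2 + 6 * r ^ 2) / (1 / 2 - separatorConst r) / √q)
      = (1 / 2 - separatorConst r - 2 * ((2 + 6 * r ^ 2) / √q)) * m := by
        rw [div_right_comm, mul_right_comm, mul_sub, mul_div_cancel₀ _ hc.ne']
        ring
    _ ≤ _ := by gcongr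

end HardHypergraphs

section Sequences

theorem tendsto_natSqrt_atTop : Tendsto Nat.sqrt atTop atTop :=
  tendsto_atTop.2 fun n => (eventually_ge_atTop (n * n)).mono fun _ => Nat.le_sqrt.2

theorem exists_tendsto_atTop_pow_four_le {u : ℕ → ℕ} (hu : Tendsto u atTop atTop) :
    ∃ q : ℕ → ℕ, Tendsto q atTop atTop ∧ ∀ i, 0 < q i ∧ q i ^ 4 ≤ max (u i) 1 := by
  have hu' : Tendsto (fun i => max (u i) 1) atTop atTop :=
    tendsto_atTop_mono (fun i => le_max_left _ _) hu
  refine ⟨fun i => ((max (u i) 1).sqrt).sqrt,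
    tendsto_natSqrt_atTop.comp (tendsto_natSqrt_atTop.comp hu'), fun i => ⟨?_, ?_⟩⟩
  · exact Nat.sqrt_pos.2 (Nat.sqrt_pos.2 (one_pos.trans_le (le_max_right _ _)))
  · calc ((max (u i) 1).sqrt).sqrt ^ 4 = (((max (u i) 1).sqrt).sqrt ^ 2) ^ 2 := pow_mul _ 2 2
      _ ≤ (max (u i) 1).sqrt ^ 2 := Nat.pow_le_pow_left (Nat.sqrt_le' _) 2
      _ ≤ max (u i) 1 := Nat.sqrt_le' _

theorem exists_seq_existsHardHypergraph {r : ℕ} (hr : 2 ≤ r) {k m : ℕ → ℕ}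
    (hk : Tendsto k atTop atTop) (hm : Tendsto m atTop atTop) :
    ∃ δ : ℕ → ℝ, Tendsto δ atTop (𝓝 0) ∧ ∀ i, ExistsHardHypergraph r (max (k i) 1) (m i)
      ((1 / 2 - separatorConst r) * m i * (1 - δ i)) := by
  obtain ⟨A, hA⟩ := exists_forall_existsHardHypergraph hr
  obtain ⟨q, hq, hq_le⟩ := exists_tendsto_atTop_pow_four_le (tendsto_inf_atTop _ hk hm)
  refine ⟨fun i => A / √(q i), tendsto_const_nhds.div_atTop
    (Real.tendsto_sqrt_atTop.comp (tendsto_natCast_atTop_atTop.comp hq)), fun i => ?_⟩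
  rcases (m i).eq_zero_or_pos with hmi | hmi
  · simp only [hmi, Nat.cast_zero, mul_zero, zero_mul]
    exact existsHardHypergraph_zero r _ le_rfl
  obtain ⟨hqi, hqi_le⟩ := hq_le i
  have hqk : q i ^ 4 ≤ max (k i) 1 := hqi_le.trans (max_le_max inf_le_left le_rfl)
  have hqm : q i ^ 4 ≤ m i := hqi_le.trans (max_le inf_le_right hmi)
  exact hA (q i) _ _ hqi ((Nat.pow_le_pow_right hqi (by norm_num)).trans hqk) hqm

theorem exists_isUniform_seq_forall_isBalancedSeparator_le {r : ℕ} (hr : 2 ≤ r) {k m : ℕ → ℕ}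
    (hk : Tendsto k atTop atTop) (hm : Tendsto m atTop atTop) :
    ∃ (n : ℕ → ℕ) (H : ∀ i, Hypergraph (Fin (n i))) (δ : ℕ → ℝ),
      (∀ i, (H i).IsUniform r ∧ E(H i).ncard = m i) ∧
      (∀ᶠ i in atTop, (H i).maxDegree ≤ k i) ∧
      Tendsto δ atTop (𝓝 0) ∧
      ∀ i, ∀ R, (H i).IsBalancedSeparator R →
        (1 / 2 - separatorConst r) * (m i : ℝ) * (1 - δ i) ≤ (R.ncard : ℝ) := by
  obtain ⟨δ, hδ, h⟩ := exists_seq_existsHardHypergraph hr hk hm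
  choose n H hH hE hdeg hsep using h
  refine ⟨n, H, δ, fun i => ⟨hH i, hE i⟩, ?_, hδ, hsep⟩
  filter_upwards [hk.eventually_ge_atTop 1] with i hi
  exact (hdeg i).trans_eq (max_eq_left hi)

theorem isLittleO_sqrt_pow_four {d : ℕ → ℕ} (hd : ∀ᶠ i in atTop, d i ≤ i) :
    (fun i => (d i : ℝ)) =o[atTop] fun i : ℕ => √((i ^ 4 : ℕ) : ℝ) := by
  have hsqrt (i : ℕ) : √((i ^ 4 : ℕ) : ℝ) = (i : ℝ) ^ 2 := by
    rw [Nat.cast_pow, pow_mul (i : ℝ) 2 2, Real.sqrt_sq (by positivity)]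
  simp only [hsqrt]
  have hd' : (fun i => (d i : ℝ)) =O[atTop] fun i : ℕ => (i : ℝ) :=
    .of_bound' (hd.mono fun i hi => by simpa using hi)
  refine hd'.trans_isLittleO ?_
  simpa only [pow_one] using (isLittleO_pow_pow_atTop_of_lt (𝕜 := ℝ) one_lt_two).natCast_atTop

theorem le_of_forall_mul_one_sub_le_mul_add {a b : ℝ} {m δ err : ℕ → ℝ}
    (hm : ∀ᶠ i in atTop, 0 < m i) (hδ : Tendsto δ atTop (𝓝 0)) (herr : err =o[atTop] m)
    (h : ∀ i, a * m i * (1 - δ i) ≤ b * m i + err i) : a ≤ b := by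
  have hleft : Tendsto (fun i => a * (1 - δ i)) atTop (𝓝 a) := by
    simpa using (hδ.const_sub 1).const_mul a
  have hright : Tendsto (fun i => b + err i / m i) atTop (𝓝 b) := by
    simpa using herr.tendsto_div_nhds_zero.const_add b
  refine le_of_tendsto_of_tendsto hleft hright (hm.mono fun i hi => ?_)
  refine le_of_mul_le_mul_right ?_ hi
  rw [add_mul, div_mul_cancel₀ _ hi.ne']
  linarith [h i]

theorem not_separatorBound {r : ℕ} (hr : 2 ≤ r) {ε : ℝ} (hε : separatorConst r < ε) :
    ¬ SeparatorBound r ε := by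
  intro hbound
  have hm : Tendsto (fun i : ℕ => i ^ 4) atTop atTop := tendsto_pow_atTop (by norm_num)
  obtain ⟨n, H, δ, hH, hdeg, hδ, hsep⟩ :=
    exists_isUniform_seq_forall_isBalancedSeparator_le hr tendsto_id hm
  have hE (i : ℕ) : E(H i).ncard = i ^ 4 := (hH i).2
  obtain ⟨err, herr, hR⟩ := hbound n H (fun i e he => ((hH i).1 e he).le) (by simpa only [hE])
    (by simpa only [hE] using isLittleO_sqrt_pow_four hdeg)
  simp only [hE] at herr hR
  have hle : 1 / 2 - separatorConst r ≤ 1 / 2 - ε := by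
    refine le_of_forall_mul_one_sub_le_mul_add ?_ hδ herr fun i => ?_
    · filter_upwards [hm.eventually_gt_atTop 0] with i hi using Nat.cast_pos.2 hi
    · obtain ⟨R, hR_sep, hR_card⟩ := hR i
      exact (hsep i R hR_sep).trans hR_card
  linarith

end Sequences

theorem mainTheorem4_general (r : ℕ) (hr : 2 ≤ r) :
    (∀ k m : ℕ → ℕ, Tendsto k atTop atTop → Tendsto m atTop atTop →
      ∃ (n : ℕ → ℕ) (H : ∀ i, Hypergraph (Fin (n i))) (δ : ℕ → ℝ),
        (∀ i, (H i).IsUniform r ∧ E(H i).ncard = m i) ∧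
        (∀ᶠ i in atTop, (H i).maxDegree ≤ k i) ∧
        Tendsto δ atTop (𝓝 0) ∧
        ∀ i, ∀ R, (H i).IsBalancedSeparator R →
          (1 / 2 - separatorConst r) * (m i : ℝ) * (1 - δ i) ≤ (R.ncard : ℝ)) ∧
    (∀ ε : ℝ, separatorConst r < ε → ¬ SeparatorBound r ε) :=
  ⟨fun _ _ hk hm => exists_isUniform_seq_forall_isBalancedSeparator_le hr hk hm,
    fun _ hε => not_separatorBound hr hε⟩

theorem mainTheorem4 (r : ℕ) (hr : 2 ≤ r) :
    (∃ C : ℝ, 0 < C ∧ ∀ k m : ℕ → ℕ,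
      Tendsto k atTop atTop → Tendsto m atTop atTop →
      (fun i => (k i : ℝ)) =o[atTop] (fun i => (m i : ℝ)) →
      ∃ (n : ℕ → ℕ) (H : ∀ i, Hypergraph (Fin (n i))) (δ : ℕ → ℝ),
        (∀ i, (H i).IsUniform r ∧ E(H i).ncard = m i) ∧
        (∀ᶠ i in atTop, ((H i).maxDegree : ℝ) ≤ C * (k i : ℝ)) ∧
        Tendsto δ atTop (𝓝 0) ∧
        ∀ i, ∀ R, (H i).IsBalancedSeparator R →
          (1 / 2 - separatorConst r) * (m i : ℝ) * (1 - δ i) ≤ (R.ncard : ℝ)) ∧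
    (∀ ε : ℝ, separatorConst r < ε → ¬ SeparatorBound r ε) :=
  ⟨⟨1, one_pos, fun k m hk hm _ => by
    simpa only [one_mul, Nat.cast_le] using (mainTheorem4_general r hr).1 k m hk hm⟩,
    (mainTheorem4_general r hr).2⟩
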